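/- Theorem 5.1. Let $G=(V,E)$ be a finite, simple, connected graph with shortest-path distance $d$, and let $I_G:V\times V\to 2^V$, $I_G(u,v)=\{w\in V : d(u,w)+d(w,v)=d(u,v)\}$, be its interval function. Then $R=I_G$ satisfies both of the axioms - $(J0')$: for all pairwise distinct $u,x,y,v\in V$, if $x\in R(u,y)$, $y\in R(x,v)$ and $R(u,y)\cap R(x,v)\subsetneq\{u,x,y,v\}$, then $x\in R(u,v)$; - $(br)$: for all (not necessarily distinct) $u,v,x,y,z\in V$, if $R(x,y)=\{x,y\}$, $R(x,u)=\{x,u\}$, $R(v,y)=\{v,y\}$ and $z\in R(u,v)$, then $R(x,z)=\{x,z\}$ or $R(y,z)=\{y,z\}$; if and only if $G$ is a bridged graph, that is, $G$ has no isometric cycle of length greater than $3$. Here a cycle $C$ in $G$ is isometric if $d_C(a,b)=d(a,b)$ for all vertices $a,b$ of $C$, where $d_C$ is the distance within $C$. -/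

import Mathlib

namespace MetricGraph

variable {V : Type*}

/-- The interval function `I_G` of a graph: `w` lies in `I_G(u, v)` when
`d(u, w) + d(w, v) = d(u, v)` for the shortest-path distance of `G`. -/
def interval (G : SimpleGraph V) (u v : V) : Set V :=
  {w | G.dist u w + G.dist w v = G.dist u v}

/-- The axiom (J0') for a function `R : V × V → 2^V`. The inclusion is proper. -/
def AxiomJ0' (R : V → V → Set V) : Prop :=
  ∀ u x y v : V, u ≠ x → u ≠ y → u ≠ v → x ≠ y → x ≠ v → y ≠ v →
    x ∈ R u y → y ∈ R x v → R u y ∩ R x v ⊂ {u, x, y, v} → x ∈ R u v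

/-- The axiom (br) for a function `R : V × V → 2^V`; the points need not be distinct. -/
def AxiomBr (R : V → V → Set V) : Prop :=
  ∀ u v x y z : V, R x y = {x, y} → R x u = {x, u} → R v y = {v, y} → z ∈ R u v →
    R x z = {x, z} ∨ R y z = {y, z}

/-- A subgraph `H` of `G` is isometric when distances inside `H` agree with distances in `G`. -/
def IsIsometric {G : SimpleGraph V} (H : G.Subgraph) : Prop :=
  ∀ a b : H.verts, H.coe.dist a b = G.dist (a : V) (b : V)

/-- A graph is bridged when no isometric subgraph of it is a cycle of length greater than 3. -/
def IsBridged (G : SimpleGraph V) : Prop :=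
  ∀ (n : ℕ), 3 < n → ∀ H : G.Subgraph, Nonempty (SimpleGraph.cycleGraph n ≃g H.coe) →
    ¬ IsIsometric H

end MetricGraph

namespace MetricGraph

open SimpleGraph

variable {V : Type*} {G : SimpleGraph V}

/-! Both sides of the equivalence amount to the triangle and clique conditions at every level,
together with the absence of induced 4- and 5-cycles.

Bridged to conditions: the two conditions are proved together by induction on the level. A failure
closes up, along two geodesics, into a closed walk of odd length (triangle) or even length (clique).
By the lower levels the failure reappears when the base vertex moves to a vertex about halfway round
(`TriangleFailsAt.rotate`, `CliqueFailsAt.rotate`). Iterating puts all antipodal pairs at full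
distance, so the walk is an isometric cycle.

Conditions to axioms: if (J0') fails, `exists_common_neighbor` produces a further vertex in the
intersection of the two intervals. For (br) only distances up to 3 matter.

Axioms to conditions: (br) excludes induced squares and pentagons, and (J0') then supplies the
common neighbours that both conditions need.

Conditions to bridged: in an isometric cycle, the vertices opposite a base vertex contradict the
conditions, except in length 5, which `NoPentagon` excludes. -/

/-- Adjacent vertices at distance `k` from `v` have a common neighbour at distance `k - 1`. -/
def TriangleCondition (G : SimpleGraph V) (k : ℕ) : Prop :=
  ∀ v u x : V, G.dist u x = 1 → G.dist v u = k → G.dist v x = k →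
    ∃ t, G.dist t u = 1 ∧ G.dist t x = 1 ∧ G.dist v t + 1 = k

/-- The neighbours of `x` that lie on geodesics from `x` to a vertex at distance `k + 1`
form a clique. -/
def CliqueCondition (G : SimpleGraph V) (k : ℕ) : Prop :=
  ∀ v x y z : V, G.dist v x = k + 1 → G.dist v y = k → G.dist v z = k →
    G.dist x y = 1 → G.dist x z = 1 → G.dist y z ≤ 1

/-- Every closed walk of length four has a diagonal of length at most one. -/
def NoSquare (G : SimpleGraph V) : Prop :=
  ∀ a b c d : V, G.dist a b = 1 → G.dist b c = 1 → G.dist c d = 1 → G.dist d a = 1 →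
    G.dist a c ≤ 1 ∨ G.dist b d ≤ 1

/-- Every closed walk of length five has a diagonal of length at most one. -/
def NoPentagon (G : SimpleGraph V) : Prop :=
  ∀ a b c d e : V, G.dist a b = 1 → G.dist b c = 1 → G.dist c d = 1 → G.dist d e = 1 →
    G.dist e a = 1 → G.dist a c ≤ 1 ∨ G.dist b d ≤ 1 ∨ G.dist c e ≤ 1 ∨ G.dist d a ≤ 1 ∨
      G.dist e b ≤ 1

/-! ### Closed walks and isometric cycles -/

/-- A closed walk of length `n`, as a periodic sequence. -/
structure IsClosedWalk (G : SimpleGraph V) (n : ℕ) (c : ℕ → V) : Prop where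
  periodic : ∀ i, c (i + n) = c i
  adj : ∀ i, G.Adj (c i) (c (i + 1))

lemma exists_walk_of_adj_succ {W : Type*} {K : SimpleGraph W} {c : ℕ → W}
    (h : ∀ i, K.Adj (c i) (c (i + 1))) (i m : ℕ) :
    ∃ w : K.Walk (c i) (c (i + m)), w.length = m := by
  induction m with
  | zero => exact ⟨.nil, rfl⟩
  | succ m ih =>
    obtain ⟨w, hw⟩ := ih
    exact ⟨w.concat (h (i + m)), by simp [hw]⟩

lemma dist_le_of_adj_succ {W : Type*} {K : SimpleGraph W} {c : ℕ → W}
    (h : ∀ i, K.Adj (c i) (c (i + 1))) (i m : ℕ) : K.dist (c i) (c (i + m)) ≤ m := by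
  obtain ⟨w, hw⟩ := exists_walk_of_adj_succ h i m
  exact (dist_le w).trans hw.le

namespace IsClosedWalk

variable {n : ℕ} {c : ℕ → V}

lemma add_mul (h : IsClosedWalk G n c) (i m : ℕ) : c (i + n * m) = c i := by
  induction m with
  | zero => rfl
  | succ m ih => rw [Nat.mul_succ, ← add_assoc, h.periodic, ih]

lemma apply_mod (h : IsClosedWalk G n c) (i : ℕ) : c (i % n) = c i := by
  conv_rhs => rw [← Nat.mod_add_div i n, h.add_mul]

lemma dist_le (h : IsClosedWalk G n c) (i m : ℕ) : G.dist (c i) (c (i + m)) ≤ m :=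
  dist_le_of_adj_succ h.adj i m

lemma dist_eq_one (h : IsClosedWalk G n c) (i : ℕ) : G.dist (c i) (c (i + 1)) = 1 :=
  dist_eq_one_iff_adj.2 (h.adj i)

/-- An arc running to the antipode is a geodesic, hence so is each of its initial pieces. -/
lemma dist_eq_of_le_half (h : IsClosedWalk G n c) (hG : G.Connected)
    (half : ∀ i, G.dist (c i) (c (i + n / 2)) = n / 2) (i : ℕ) {m : ℕ} (hm : m ≤ n / 2) :
    G.dist (c i) (c (i + m)) = m := by
  have h1 := h.dist_le i m
  have h2 := h.dist_le (i + m) (n / 2 - m)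
  rw [show i + m + (n / 2 - m) = i + n / 2 by omega] at h2
  have h3 := hG.dist_triangle (u := c i) (v := c (i + m)) (w := c (i + n / 2))
  have := half i
  omega

lemma dist_eq_of_half_le (h : IsClosedWalk G n c) (hG : G.Connected)
    (half : ∀ i, G.dist (c i) (c (i + n / 2)) = n / 2) (i : ℕ) {m : ℕ} (hm : n ≤ 2 * m)
    (hn : m ≤ n) : G.dist (c i) (c (i + m)) = n - m := by
  have := h.dist_eq_of_le_half hG half (i + m) (m := n - m) (by omega)
  rwa [show i + m + (n - m) = i + n by omega, h.periodic, SimpleGraph.dist_comm] at this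

lemma dist_eq_min (h : IsClosedWalk G n c) (hG : G.Connected)
    (half : ∀ i, G.dist (c i) (c (i + n / 2)) = n / 2) {i j : ℕ} (hij : i ≤ j) (hj : j ≤ i + n) :
    G.dist (c i) (c j) = min (j - i) (n - (j - i)) := by
  obtain ⟨m, rfl⟩ := Nat.exists_eq_add_of_le hij
  rcases le_or_gt m (n / 2) with hm | hm
  · rw [h.dist_eq_of_le_half hG half i hm]; omega
  · rw [h.dist_eq_of_half_le hG half i (by omega) (by omega)]; omega

/-- A closed walk along which antipodal vertices are as far apart as the length of the walk
allows is an isometric cycle. -/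
lemma not_isBridged (h : IsClosedWalk G n c) (hG : G.Connected) (hn : 3 < n)
    (half : ∀ i, G.dist (c i) (c (i + n / 2)) = n / 2) : ¬ IsBridged G := by
  intro hB
  let H : G.Subgraph := (⊤ : G.Subgraph).induce (Set.range c)
  let b : ℕ → H.verts := fun i => ⟨c i, i, rfl⟩
  have hadj : ∀ i j, H.coe.Adj (b i) (b j) ↔ G.dist (c i) (c j) = 1 := by
    intro i j
    rw [dist_eq_one_iff_adj]
    simp [H, b]
  have hb : ∀ i, H.coe.Adj (b i) (b (i + 1)) := fun i => (hadj _ _).2 (h.dist_eq_one i)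
  have hbper : ∀ i, b (i + n) = b i := fun i => Subtype.ext (h.periodic i)
  have hbmod : ∀ i, b (i % n) = b i := fun i => Subtype.ext (h.apply_mod i)
  have hdist : ∀ i j : ℕ, i ≤ j → j < n → G.dist (c i) (c j) = min (j - i) (n - (j - i)) :=
    fun i j hij hj => h.dist_eq_min hG half hij (by omega)
  -- The two arcs inside `H` bound the distance in `H` from above; mapping a shortest walk of `H`
  -- into `G` bounds it from below.
  have key : ∀ i j : ℕ, i ≤ j → j < n → H.coe.dist (b i) (b j) = G.dist (c i) (c j) := by
    intro i j hij hj
    have e := hdist i j hij hj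
    obtain ⟨m, rfl⟩ := Nat.exists_eq_add_of_le hij
    obtain ⟨w, hw⟩ := exists_walk_of_adj_succ hb i m
    have h1 := SimpleGraph.dist_le w
    have h2 := dist_le_of_adj_succ hb (i + m) (n - m)
    rw [show i + m + (n - m) = i + n by omega, hbper, SimpleGraph.dist_comm] at h2
    obtain ⟨w', hw'⟩ := (Walk.reachable w).exists_walk_length_eq_dist
    have h3 : G.dist (c i) (c (i + m)) ≤ _ := SimpleGraph.dist_le (w'.map H.hom)
    rw [Walk.length_map] at h3
    omega
  have hinj : ∀ i j : ℕ, i ≤ j → j < n → c i = c j → i = j := by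
    intro i j hij hj e
    have := hdist i j hij hj
    rw [e, dist_self] at this
    omega
  have hbij : Function.Bijective (fun i : Fin n => b i) := by
    constructor
    · intro i j e
      have e' : c i = c j := congrArg Subtype.val e
      apply Fin.ext
      rcases le_total i.val j.val with hij | hij
      · exact hinj _ _ hij j.2 e'
      · exact (hinj _ _ hij i.2 e'.symm).symm
    · rintro ⟨_, i, rfl⟩
      exact ⟨⟨i % n, Nat.mod_lt _ (by omega)⟩, hbmod i⟩
  refine hB n hn H ⟨⟨Equiv.ofBijective _ hbij, ?_⟩⟩ ?_
  · intro i j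
    rw [cycleGraph_adj']
    change H.coe.Adj (b i) (b j) ↔ _
    rw [hadj]
    rcases le_total i j with hij | hij
    · rw [hdist _ _ hij j.2, Fin.coe_sub_iff_le.2 hij]
      rcases hij.lt_or_eq with hlt | rfl
      · rw [Fin.coe_sub_iff_lt.2 hlt]; simp only [Fin.lt_def] at hlt; omega
      · simp [Fin.coe_sub_iff_le.2 le_rfl]
    · rw [SimpleGraph.dist_comm, hdist _ _ hij i.2, Fin.coe_sub_iff_le.2 hij]
      rcases hij.lt_or_eq with hlt | rfl
      · rw [Fin.coe_sub_iff_lt.2 hlt]; simp only [Fin.lt_def] at hlt; omega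
      · simp [Fin.coe_sub_iff_le.2 le_rfl]
  · intro x y
    obtain ⟨i, rfl⟩ := hbij.2 x
    obtain ⟨j, rfl⟩ := hbij.2 y
    rcases le_total i.val j.val with hij | hij
    · exact key _ _ hij j.2
    · have := key _ _ hij i.2
      rwa [SimpleGraph.dist_comm, SimpleGraph.dist_comm (u := c j)] at this

end IsClosedWalk

lemma isClosedWalk_getVert_mod {G : SimpleGraph V} {v : V} (w : G.Walk v v)
    (hw : 0 < w.length) : IsClosedWalk G w.length (fun i => w.getVert (i % w.length)) where
  periodic i := by simp
  adj i := by
    have hi := Nat.mod_lt i hw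
    have := w.adj_getVert_succ hi
    rw [Nat.add_mod]
    rcases eq_or_lt_of_le (Nat.succ_le_of_lt hi) with e | e
    · have h1 : (i % w.length + 1 % w.length) % w.length = 0 := by
        rw [Nat.add_mod_mod, show i % w.length + 1 = w.length from e, Nat.mod_self]
      rw [h1, Walk.getVert_zero]
      rw [show i % w.length + 1 = w.length from e, Walk.getVert_length] at this
      exact this
    · rwa [Nat.add_mod_mod, Nat.mod_eq_of_lt e]

/-! ### Bridged graphs satisfy the metric conditions -/

lemma noSquare_of_isBridged (hG : G.Connected) (hB : IsBridged G) : NoSquare G := by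
  intro a b c d hab hbc hcd hda
  by_contra! hcon
  have hac := hG.dist_triangle (u := a) (v := b) (w := c)
  have hbd := hG.dist_triangle (u := b) (v := c) (w := d)
  rw [dist_eq_one_iff_adj] at hab hbc hcd hda
  let w : G.Walk a a := .cons hab (.cons hbc (.cons hcd (.cons hda .nil)))
  have hw := isClosedWalk_getVert_mod w (by simp [w])
  refine hw.not_isBridged hG (by simp [w]) (fun i => ?_) hB
  simp only [w, Walk.length_cons, Walk.length_nil]
  have hca := G.dist_comm (u := c) (v := a)
  have hdb := G.dist_comm (u := d) (v := b)
  rw [← dist_eq_one_iff_adj] at hab hbc hcd hda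
  have : i % 4 = 0 ∨ i % 4 = 1 ∨ i % 4 = 2 ∨ i % 4 = 3 := by omega
  rcases this with h | h | h | h <;>
    simp [Nat.add_mod, h, Walk.getVert] <;> omega

lemma noPentagon_of_isBridged (hG : G.Connected) (hB : IsBridged G) : NoPentagon G := by
  intro a b c d e hab hbc hcd hde hea
  by_contra! hcon
  have hac := hG.dist_triangle (u := a) (v := b) (w := c)
  have hbd := hG.dist_triangle (u := b) (v := c) (w := d)
  have hce := hG.dist_triangle (u := c) (v := d) (w := e)
  have hda := hG.dist_triangle (u := d) (v := e) (w := a)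
  have heb := hG.dist_triangle (u := e) (v := a) (w := b)
  rw [dist_eq_one_iff_adj] at hab hbc hcd hde hea
  let w : G.Walk a a := .cons hab (.cons hbc (.cons hcd (.cons hde (.cons hea .nil))))
  have hw := isClosedWalk_getVert_mod w (by simp [w])
  refine hw.not_isBridged hG (by simp [w]) (fun i => ?_) hB
  simp only [w, Walk.length_cons, Walk.length_nil]
  rw [← dist_eq_one_iff_adj] at hab hbc hcd hde hea
  have : i % 5 = 0 ∨ i % 5 = 1 ∨ i % 5 = 2 ∨ i % 5 = 3 ∨ i % 5 = 4 := by omega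
  rcases this with h | h | h | h | h <;>
    simp [Nat.add_mod, h, Walk.getVert] <;> omega

/-- Two nonadjacent neighbours of `x` closer to `v` have no common neighbour at their own
distance from `v`. -/
lemma dist_le_one_of_common_neighbor (hG : G.Connected) (h4 : NoSquare G) (h5 : NoPentagon G)
    {k : ℕ} (hT : TriangleCondition G (k + 1)) (hC : CliqueCondition G k) {v x y z t : V}
    (hx : G.dist v x = k + 2) (hy : G.dist v y = k + 1) (hz : G.dist v z = k + 1)
    (ht : G.dist v t = k + 1) (hxy : G.dist x y = 1) (hxz : G.dist x z = 1)
    (hty : G.dist t y = 1) (htz : G.dist t z = 1) : G.dist y z ≤ 1 := by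
  -- The common neighbours `r`, `s` one level down are equal or adjacent by the clique condition at
  -- `t`. This closes a square or pentagon through `x`; since `r` and `s` lie two levels below `x`,
  -- its chords lead to `y` and `z` being adjacent.
  obtain ⟨r, hrt, hry, hvr⟩ := hT v t y hty ht hy
  obtain ⟨s, hst, hsz, hvs⟩ := hT v t z htz ht hz
  have hrx := hG.dist_triangle (u := v) (v := r) (w := x)
  have hsx := hG.dist_triangle (u := v) (v := s) (w := x)
  have hyx : G.dist y x = 1 := by rwa [SimpleGraph.dist_comm]
  have hzx : G.dist z x = 1 := by rwa [SimpleGraph.dist_comm]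
  have hyr : G.dist y r = 1 := by rwa [SimpleGraph.dist_comm]
  have hzs : G.dist z s = 1 := by rwa [SimpleGraph.dist_comm]
  have hxr : G.dist x r = G.dist r x := SimpleGraph.dist_comm
  have hxs : G.dist x s = G.dist s x := SimpleGraph.dist_comm
  have hzy : G.dist z y = G.dist y z := SimpleGraph.dist_comm
  have hrs := hC v t r s ht (by omega) (by omega) (by rwa [SimpleGraph.dist_comm])
    (by rwa [SimpleGraph.dist_comm])
  rcases Nat.le_one_iff_eq_zero_or_eq_one.1 hrs with hrs | hrs
  · obtain rfl := hG.dist_eq_zero_iff.1 hrs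
    have := h4 y r z x hyr hsz hzx hxy
    omega
  · have h := h5 y r s z x hyr hrs hsz hzx hxy
    have hys : G.dist y s ≤ 1 → G.dist y z ≤ 1 := by
      intro hle
      rcases Nat.le_one_iff_eq_zero_or_eq_one.1 hle with h0 | h1
      · obtain rfl := hG.dist_eq_zero_iff.1 h0; omega
      · have := h4 y s z x h1 hsz hzx hxy
        omega
    have hzr : G.dist r z ≤ 1 → G.dist y z ≤ 1 := by
      intro hle
      rcases Nat.le_one_iff_eq_zero_or_eq_one.1 hle with h0 | h1
      · obtain rfl := hG.dist_eq_zero_iff.1 h0; omega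
      · have := h4 y r z x hyr h1 hzx hxy
        omega
    rcases h with h | h | h | h | h
    · exact hys h
    · exact hzr h
    · omega
    · omega
    · omega

lemma triangleCondition_zero (hG : G.Connected) : TriangleCondition G 0 := by
  intro v u x hux hu hx
  rw [hG.dist_eq_zero_iff] at hu hx
  subst hu hx
  simp at hux

lemma cliqueCondition_zero (hG : G.Connected) : CliqueCondition G 0 := by
  intro v x y z hx hy hz hxy hxz
  rw [hG.dist_eq_zero_iff] at hy hz
  subst hy hz
  simp

/-- The pair `c (i + k + 1)`, `c (i + k + 2)` violates the triangle condition with respect to the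
base vertex `c i`. -/
def TriangleFailsAt (G : SimpleGraph V) (k : ℕ) (c : ℕ → V) (i : ℕ) : Prop :=
  G.dist (c i) (c (i + (k + 1))) = k + 1 ∧ G.dist (c i) (c (i + (k + 2))) = k + 1 ∧
    ∀ t, G.dist t (c (i + (k + 1))) = 1 → G.dist t (c (i + (k + 2))) = 1 → G.dist (c i) t ≠ k

/-- With `q₁` the vertex before `v` on the walk, the base moves to `u` and the pair to `q₁`, `v`. A
common neighbour refuting the new failure would, by the clique condition at `q₁`, be a neighbour of
`v` at distance `k` from both `u` and `x`, and the triangle condition seen from it would repair the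
old failure. -/
lemma TriangleFailsAt.rotate (hG : G.Connected) {k : ℕ} (hk : 0 < k) {c : ℕ → V}
    (hw : IsClosedWalk G (2 * k + 3) c) (hT : TriangleCondition G k) (hC : CliqueCondition G k)
    {i : ℕ} (h : TriangleFailsAt G k c i) : TriangleFailsAt G k c (i + (k + 1)) := by
  obtain ⟨hu, hx, hno⟩ := h
  have hux := hw.dist_eq_one (i + (k + 1))
  have hq12 := hw.dist_eq_one (i + (2 * k + 1))
  have hq1v := hw.dist_eq_one (i + (2 * k + 2))
  have hxq2 := hw.dist_le (i + (k + 2)) (k - 1)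
  have huq1 := hw.dist_le (i + (k + 1)) (k + 1)
  rw [show i + (k + 1) + 1 = i + (k + 2) by ring] at hux
  rw [show i + (2 * k + 1) + 1 = i + (2 * k + 2) by ring] at hq12
  rw [show i + (2 * k + 2) + 1 = i + (2 * k + 3) by ring, hw.periodic] at hq1v
  rw [show i + (k + 2) + (k - 1) = i + (2 * k + 1) by omega] at hxq2
  rw [show i + (k + 1) + (k + 1) = i + (2 * k + 2) by ring] at huq1
  unfold TriangleFailsAt
  rw [show i + (k + 1) + (k + 1) = i + (2 * k + 2) by ring,
    show i + (k + 1) + (k + 2) = i + (2 * k + 3) by ring, hw.periodic]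
  generalize c i = v at *
  generalize c (i + (k + 1)) = u at *
  generalize c (i + (k + 2)) = x at *
  generalize c (i + (2 * k + 1)) = q₂ at *
  generalize c (i + (2 * k + 2)) = q₁ at *
  -- a vertex seeing both `u` and `x` at distance `k` lies too far from `v`
  have far : ∀ q, G.dist q u = k → G.dist q x = k → G.dist v q ≠ 1 := by
    intro q hqu hqx hvq
    obtain ⟨t, htu, htx, hqt⟩ := hT q u x hux hqu hqx
    have h1 := hG.dist_triangle (u := v) (v := q) (w := t)
    have h2 := hG.dist_triangle (u := v) (v := t) (w := u)
    exact hno t htu htx (by omega)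
  have hvq1 : G.dist v q₁ = 1 := by rwa [SimpleGraph.dist_comm]
  have hq1u := G.dist_comm (u := q₁) (v := u)
  have hq1x := hG.dist_triangle (u := q₁) (v := q₂) (w := x)
  have hq2q1 := G.dist_comm (u := q₂) (v := q₁)
  have hq2x := G.dist_comm (u := q₂) (v := x)
  have h1 := hG.dist_triangle (u := v) (v := q₁) (w := u)
  have h2 := hG.dist_triangle (u := v) (v := q₁) (w := x)
  have hq1u' : G.dist q₁ u = k + 1 := by
    by_contra hne
    exact far q₁ (by omega) (by omega) hvq1
  refine ⟨by omega, by rw [SimpleGraph.dist_comm]; exact hu, fun t htq htv htu => ?_⟩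
  have h3 := hG.dist_triangle (u := u) (v := x) (w := q₂)
  have h4 := hG.dist_triangle (u := u) (v := q₂) (w := q₁)
  have htq2 := hC u q₁ t q₂ (by omega) htu (by omega) (by rwa [SimpleGraph.dist_comm])
    (by omega)
  have h5 := hG.dist_triangle (u := t) (v := q₂) (w := x)
  have h6 := hG.dist_triangle (u := v) (v := t) (w := x)
  have hvt := G.dist_comm (u := v) (v := t)
  have hut := G.dist_comm (u := t) (v := u)
  exact far t (by omega) (by omega) (by omega)

lemma triangleCondition_succ (hG : G.Connected) (hB : IsBridged G) {k : ℕ}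
    (hT : TriangleCondition G k) (hC : CliqueCondition G k) :
    TriangleCondition G (k + 1) := by
  intro v u x hux hu hx
  rcases Nat.eq_zero_or_pos k with rfl | hk
  · exact ⟨v, by simpa using hu, by simpa using hx, by simp⟩
  by_contra! hno
  obtain ⟨p, hp⟩ := hG.exists_walk_length_eq_dist v u
  obtain ⟨q, hq⟩ := hG.exists_walk_length_eq_dist x v
  rw [SimpleGraph.dist_comm] at hq
  let w := p.append (.cons (dist_eq_one_iff_adj.1 hux) q)
  have hwl : w.length = 2 * k + 3 := by simp [w]; omega
  have hw := isClosedWalk_getVert_mod w (by omega)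
  set c : ℕ → V := fun i => w.getVert (i % w.length) with hc
  rw [hwl] at hw
  have hcv : c 0 = v := by simp [hc]
  have hcu : c (k + 1) = u := by
    simp only [hc]
    rw [Nat.mod_eq_of_lt (by omega), Walk.getVert_append, if_neg (by omega), hp, hu]
    simp
  have hcx : c (k + 2) = x := by
    simp only [hc]
    rw [Nat.mod_eq_of_lt (by omega), Walk.getVert_append, if_neg (by omega), hp, hu,
      show k + 2 - (k + 1) = 0 + 1 by omega, Walk.getVert_cons_succ]
    simp
  have bad : ∀ m, TriangleFailsAt G k c ((k + 1) * m) := by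
    intro m
    induction m with
    | zero =>
      refine ⟨?_, ?_, fun t => ?_⟩
      · simpa [hcv, hcu] using hu
      · simpa [hcv, hcx] using hx
      · simpa [hcv, hcu, hcx] using hno t
    | succ m ih => exact ih.rotate hG hk hw hT hC
  refine hw.not_isBridged hG (by omega) (fun i => ?_) hB
  -- `(k + 1) * (4 * (k + 1) * i)` is congruent to `i` modulo `2 * k + 3`
  have h := (bad (4 * (k + 1) * i)).1
  rw [show (k + 1) * (4 * (k + 1) * i) = i + (2 * k + 3) * ((2 * k + 1) * i) by ring,
    hw.add_mul, show i + (2 * k + 3) * ((2 * k + 1) * i) + (k + 1) =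
      i + (k + 1) + (2 * k + 3) * ((2 * k + 1) * i) by ring, hw.add_mul] at h
  rwa [show (2 * k + 3) / 2 = k + 1 by omega]

/-- The neighbours `c (i + k + 1)`, `c (i + k + 3)` of `c (i + k + 2)` violate the clique condition
with respect to the base vertex `c i`. -/
def CliqueFailsAt (G : SimpleGraph V) (k : ℕ) (c : ℕ → V) (i : ℕ) : Prop :=
  G.dist (c i) (c (i + (k + 2))) = k + 2 ∧ 1 < G.dist (c (i + (k + 1))) (c (i + (k + 3)))

/-- Let `q` be the vertex before `v`. If `d(q, y) ≤ k`, the clique condition from `q` joins `y` and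
`z`. If `d(q, y) = k + 1`, the triangle condition gives a `t` that either equals `z` or is a common
neighbour excluded by `dist_le_one_of_common_neighbor`. -/
lemma CliqueFailsAt.dist_eq (hG : G.Connected) (h4 : NoSquare G) (h5 : NoPentagon G)
    {k : ℕ} {c : ℕ → V} (hw : IsClosedWalk G (2 * k + 4) c)
    (hT : TriangleCondition G (k + 1)) (hC : CliqueCondition G k)
    {i : ℕ} (h : CliqueFailsAt G k c i) :
    G.dist (c (i + (k + 1))) (c (i + (2 * k + 3))) = k + 2 := by
  obtain ⟨hx, hyz⟩ := h
  have hxy := hw.dist_eq_one (i + (k + 1))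
  have hxz := hw.dist_eq_one (i + (k + 2))
  have hq1v := hw.dist_eq_one (i + (2 * k + 3))
  have hvy := hw.dist_le i (k + 1)
  have hzq1 := hw.dist_le (i + (k + 3)) k
  have hyq1 := hw.dist_le (i + (k + 1)) (k + 2)
  rw [show i + (k + 1) + 1 = i + (k + 2) by ring] at hxy
  rw [show i + (k + 2) + 1 = i + (k + 3) by ring] at hxz
  rw [show i + (2 * k + 3) + 1 = i + (2 * k + 4) by ring, hw.periodic] at hq1v
  rw [show i + (k + 3) + k = i + (2 * k + 3) by ring] at hzq1
  rw [show i + (k + 1) + (k + 2) = i + (2 * k + 3) by ring] at hyq1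
  generalize c i = v at *
  generalize c (i + (k + 1)) = y at *
  generalize c (i + (k + 2)) = x at *
  generalize c (i + (k + 3)) = z at *
  generalize c (i + (2 * k + 3)) = q at *
  have hxy' : G.dist x y = 1 := by rwa [SimpleGraph.dist_comm]
  have hqv := G.dist_comm (u := q) (v := v)
  have hzq := G.dist_comm (u := q) (v := z)
  have hyq := G.dist_comm (u := q) (v := y)
  have hzx := G.dist_comm (u := z) (v := x)
  have t1 := hG.dist_triangle (u := v) (v := y) (w := x)
  have t2 := hG.dist_triangle (u := v) (v := z) (w := x)
  have t3 := hG.dist_triangle (u := v) (v := q) (w := z)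
  have t4 := hG.dist_triangle (u := v) (v := q) (w := x)
  have t5 := hG.dist_triangle (u := q) (v := z) (w := x)
  have t6 := hG.dist_triangle (u := q) (v := y) (w := x)
  rcases lt_trichotomy (G.dist q y) (k + 1) with hlt | heq | hgt
  · have := hC q x y z (by omega) (by omega) (by omega) hxy' hxz
    omega
  · obtain ⟨t, hty, htx, hqt⟩ := hT q y x hxy heq (by omega)
    have hxt : G.dist x t = 1 := by rwa [SimpleGraph.dist_comm]
    have htz := hC q x t z (by omega) (by omega) (by omega) hxt hxz
    have t7 := hG.dist_triangle (u := v) (v := q) (w := t)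
    have t8 := hG.dist_triangle (u := v) (v := t) (w := x)
    rcases Nat.le_one_iff_eq_zero_or_eq_one.1 htz with h0 | h1
    · obtain rfl := hG.dist_eq_zero_iff.1 h0
      have := G.dist_comm (u := t) (v := y)
      omega
    · have := dist_le_one_of_common_neighbor hG h4 h5 hT hC hx (by omega) (by omega)
        (by omega : G.dist v t = k + 1) hxy' hxz hty h1
      omega
  · omega

lemma CliqueFailsAt.rotate (hG : G.Connected) (h4 : NoSquare G) (h5 : NoPentagon G)
    {k : ℕ} {c : ℕ → V} (hw : IsClosedWalk G (2 * k + 4) c)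
    (hT : TriangleCondition G (k + 1)) (hC : CliqueCondition G k)
    {i : ℕ} (h : CliqueFailsAt G k c i) : CliqueFailsAt G k c (i + (k + 1)) := by
  have hd := h.dist_eq hG h4 h5 hw hT hC
  have hxq := hw.dist_le (i + (k + 2)) k
  unfold CliqueFailsAt
  rw [show i + (k + 2) + k = i + (2 * k + 2) by ring] at hxq
  rw [show i + (k + 1) + (k + 2) = i + (2 * k + 3) by ring,
    show i + (k + 1) + (k + 1) = i + (2 * k + 2) by ring,
    show i + (k + 1) + (k + 3) = i + (2 * k + 4) by ring, hw.periodic]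
  refine ⟨hd, ?_⟩
  have := hG.dist_triangle (u := c (i + (k + 2))) (v := c (i + (2 * k + 2))) (w := c i)
  have h1 := h.1
  rw [SimpleGraph.dist_comm] at h1
  omega

lemma cliqueCondition_succ (hG : G.Connected) (hB : IsBridged G) {k : ℕ}
    (hT : TriangleCondition G (k + 1)) (hC : CliqueCondition G k) :
    CliqueCondition G (k + 1) := by
  intro v x y z hx hy hz hxy hxz
  by_contra! hyz
  have h4 := noSquare_of_isBridged hG hB
  have h5 := noPentagon_of_isBridged hG hB
  obtain ⟨p, hp⟩ := hG.exists_walk_length_eq_dist v y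
  obtain ⟨q, hq⟩ := hG.exists_walk_length_eq_dist z v
  rw [SimpleGraph.dist_comm] at hq
  let w := p.append
    (.cons (dist_eq_one_iff_adj.1 hxy).symm (.cons (dist_eq_one_iff_adj.1 hxz) q))
  have hwl : w.length = 2 * k + 4 := by simp [w]; omega
  have hw := isClosedWalk_getVert_mod w (by omega)
  set c : ℕ → V := fun i => w.getVert (i % w.length) with hc
  rw [hwl] at hw
  have hcv : c 0 = v := by simp [hc]
  have hcy : c (k + 1) = y := by
    simp only [hc]
    rw [Nat.mod_eq_of_lt (by omega), Walk.getVert_append, if_neg (by omega), hp, hy]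
    simp
  have hcx : c (k + 2) = x := by
    simp only [hc]
    rw [Nat.mod_eq_of_lt (by omega), Walk.getVert_append, if_neg (by omega), hp, hy,
      show k + 2 - (k + 1) = 0 + 1 by omega, Walk.getVert_cons_succ]
    simp
  have hcz : c (k + 3) = z := by
    simp only [hc]
    rw [Nat.mod_eq_of_lt (by omega), Walk.getVert_append, if_neg (by omega), hp, hy,
      show k + 3 - (k + 1) = 0 + 1 + 1 by omega, Walk.getVert_cons_succ, Walk.getVert_cons_succ]
    simp
  have bad : ∀ m, CliqueFailsAt G k c ((k + 1) * m) := by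
    intro m
    induction m with
    | zero =>
      refine ⟨?_, ?_⟩
      · simpa [hcv, hcx] using hx
      · simpa [hcy, hcz] using hyz
    | succ m ih => exact ih.rotate hG h4 h5 hw hT hC
  -- Rotation by `k + 1` modulo `2 * k + 4` need not reach odd positions. For those,
  -- `CliqueFailsAt.dist_eq` at the next even base measures the required antipodal pair.
  have even : ∀ s, CliqueFailsAt G k c (2 * s + (2 * k + 4) * (k * s)) := by
    intro s
    have := bad (2 * (k + 1) * s)
    rwa [show (k + 1) * (2 * (k + 1) * s) = 2 * s + (2 * k + 4) * (k * s) by ring] at this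
  refine hw.not_isBridged hG (by omega) (fun i => ?_) hB
  rw [show (2 * k + 4) / 2 = k + 2 by omega]
  rcases Nat.even_or_odd' i with ⟨s, rfl | rfl⟩
  · have h := (even s).1
    rwa [hw.add_mul, show 2 * s + (2 * k + 4) * (k * s) + (k + 2) =
      2 * s + (k + 2) + (2 * k + 4) * (k * s) by ring, hw.add_mul] at h
  · have h := (even (s + 1)).dist_eq hG h4 h5 hw hT hC
    rwa [show 2 * (s + 1) + (2 * k + 4) * (k * (s + 1)) + (2 * k + 3) =
        2 * s + 1 + (2 * k + 4) * (k * (s + 1) + 1) by ring, hw.add_mul,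
      show 2 * (s + 1) + (2 * k + 4) * (k * (s + 1)) + (k + 1) =
        2 * s + 1 + (k + 2) + (2 * k + 4) * (k * (s + 1)) by ring, hw.add_mul,
      SimpleGraph.dist_comm] at h

lemma conditions_of_isBridged (hG : G.Connected) (hB : IsBridged G) (k : ℕ) :
    TriangleCondition G k ∧ CliqueCondition G k := by
  induction k with
  | zero => exact ⟨triangleCondition_zero hG, cliqueCondition_zero hG⟩
  | succ k ih =>
    have hT := triangleCondition_succ hG hB ih.1 ih.2
    exact ⟨hT, cliqueCondition_succ hG hB hT ih.2⟩

/-! ### From the conditions to the axioms -/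

lemma exists_adj_dist_eq (hG : G.Connected) {x y : V} {k : ℕ} (h : G.dist x y = k + 1) :
    ∃ w, G.dist x w = 1 ∧ G.dist w y = k := by
  obtain ⟨p, hp⟩ := hG.exists_walk_length_eq_dist x y
  cases p with
  | nil => simp at h
  | @cons _ w _ hadj q =>
    have h1 := dist_eq_one_iff_adj.2 hadj
    have h2 := dist_le q
    have h3 := hG.dist_triangle (u := x) (v := w) (w := y)
    rw [Walk.length_cons] at hp
    exact ⟨w, h1, by omega⟩

lemma interval_eq_pair_iff (hG : G.Connected) {x y : V} :
    interval G x y = {x, y} ↔ G.dist x y ≤ 1 := by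
  constructor
  · intro h
    by_contra! hlt
    obtain ⟨k, hk⟩ := Nat.exists_eq_add_of_le' hlt.le
    obtain ⟨w, hxw, hwy⟩ := exists_adj_dist_eq hG hk
    have hw : w ∈ interval G x y := by simp only [interval, Set.mem_ofPred_eq]; omega
    rw [h] at hw
    rcases hw with rfl | rfl
    · simp at hxw
    · omega
  · intro h
    ext w
    simp only [interval, Set.mem_ofPred_eq, Set.mem_insert_iff, Set.mem_singleton_iff]
    constructor
    · intro hw
      have : G.dist x w = 0 ∨ G.dist w y = 0 := by omega
      rwa [hG.dist_eq_zero_iff, hG.dist_eq_zero_iff, eq_comm (a := x)] at this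
    · rintro (rfl | rfl) <;> simp

lemma exists_common_neighbor_aux (hG : G.Connected) {b : ℕ} (hT : TriangleCondition G (b + 1))
    (hC : CliqueCondition G b) {u x y v : V} (hux : G.dist u x = 1) (huy : G.dist u y = 2)
    (hxy : G.dist x y = 1) (hvy : G.dist v y = b) (hvx : G.dist v x = b + 1)
    (huv : G.dist v u ≤ b + 1) :
    ∃ z, G.dist z u = 1 ∧ G.dist z x = 1 ∧ G.dist z y = 1 ∧ G.dist v z = b := by
  have hxu : G.dist x u = 1 := by rwa [SimpleGraph.dist_comm]
  have h1 := hG.dist_triangle (u := v) (v := u) (w := x)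
  have h2 : G.dist v u ≠ b := fun h => by
    have := hC v x u y hvx h hvy hxu hxy
    omega
  obtain ⟨z, hzu, hzx, hvz⟩ := hT v u x hux (by omega) hvx
  have hxz : G.dist x z = 1 := by rwa [SimpleGraph.dist_comm]
  have hzy := hC v x z y hvx (by omega) hvy hxz hxy
  refine ⟨z, hzu, hzx, ?_, by omega⟩
  rcases Nat.le_one_iff_eq_zero_or_eq_one.1 hzy with h0 | h0
  · obtain rfl := hG.dist_eq_zero_iff.1 h0
    rw [SimpleGraph.dist_comm] at hzu
    omega
  · exact h0

/-- Let `x'` be the neighbour of `x` towards `u`. If `x'` is no farther from `v` than `x`,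
`exists_common_neighbor_aux` applies to `x', x, y`. Otherwise induction on the edge `x' x` yields a
replacement for `x'` that is no farther. -/
lemma exists_common_neighbor (hG : G.Connected) (hT : ∀ k, TriangleCondition G k)
    (hC : ∀ k, CliqueCondition G k) (a : ℕ) : ∀ (b : ℕ) (u x y v : V), G.dist x y = 1 →
    G.dist u x = a + 1 → G.dist u y = a + 2 → G.dist v y = b → G.dist v x = b + 1 →
    G.dist u v ≤ a + 1 + b →
    ∃ z, G.dist z x = 1 ∧ G.dist z y = 1 ∧ G.dist u z = a + 1 ∧ G.dist v z = b := by
  induction a with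
  | zero =>
    intro b u x y v hxy hux huy hvy hvx huv
    rw [SimpleGraph.dist_comm] at huv
    obtain ⟨z, hzu, hzx, hzy, hvz⟩ := exists_common_neighbor_aux hG (hT _) (hC _) hux huy hxy hvy
      hvx (by omega)
    exact ⟨z, hzx, hzy, by rwa [SimpleGraph.dist_comm], hvz⟩
  | succ a ih =>
    intro b u x y v hxy hux huy hvy hvx huv
    have main : ∀ x', G.dist x x' = 1 → G.dist x' u = a + 1 → G.dist v x' ≤ b + 1 →
        ∃ z, G.dist z x = 1 ∧ G.dist z y = 1 ∧ G.dist u z = a + 1 + 1 ∧ G.dist v z = b := by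
      intro x' hx' hx'u hvx'
      have h1 := hG.dist_triangle (u := u) (v := x') (w := y)
      have h2 := hG.dist_triangle (u := x') (v := x) (w := y)
      have h3 := G.dist_comm (u := x) (v := x')
      have h4 := G.dist_comm (u := x') (v := u)
      obtain ⟨z, hzx', hzx, hzy, hvz⟩ := exists_common_neighbor_aux hG (hT _) (hC _)
        (by omega : G.dist x' x = 1) (by omega) hxy hvy hvx hvx'
      have h5 := hG.dist_triangle (u := u) (v := z) (w := y)
      have h6 := hG.dist_triangle (u := u) (v := x') (w := z)
      have h7 := G.dist_comm (u := x') (v := z)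
      exact ⟨z, hzx, hzy, by omega, hvz⟩
    rw [SimpleGraph.dist_comm] at hux
    obtain ⟨x', hxx', hx'u⟩ := exists_adj_dist_eq hG hux
    have h1 := hG.dist_triangle (u := v) (v := x) (w := x')
    rcases Nat.lt_or_ge (b + 1) (G.dist v x') with hlt | hle
    · have h3 := G.dist_comm (u := x) (v := x')
      have h4 := G.dist_comm (u := x') (v := u)
      have h5 := G.dist_comm (u := x) (v := u)
      obtain ⟨z, hzx', hzx, huz, hvz⟩ := ih (b + 1) u x' x v (by omega) (by omega) (by omega)
        hvx (by omega) (by omega)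
      exact main z (by rwa [SimpleGraph.dist_comm]) (by rwa [SimpleGraph.dist_comm]) hvz.le
    · exact main x' hxx' hx'u hle

lemma axiomJ0'_of_conditions (hG : G.Connected) (hT : ∀ k, TriangleCondition G k)
    (hC : ∀ k, CliqueCondition G k) : AxiomJ0' (interval G) := by
  intro u x y v hux _ _ hxy _ hyv hx hy hsub
  replace hsub := hsub.subset
  simp only [interval, Set.mem_ofPred_eq] at hx hy ⊢
  have pux := hG.pos_dist_of_ne hux
  have pxy := hG.pos_dist_of_ne hxy
  have pyv := hG.pos_dist_of_ne hyv
  have mem : ∀ w, G.dist u w + G.dist w y = G.dist u y → G.dist x w + G.dist w v = G.dist x v →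
      w = u ∨ w = x ∨ w = y ∨ w = v := by
    intro w h1 h2
    simpa using hsub ⟨h1, h2⟩
  -- An inner vertex of an `x`-`y` geodesic would be a fifth vertex in both intervals.
  have hadj : G.dist x y = 1 := by
    obtain ⟨k, hk⟩ := Nat.exists_eq_add_of_le' pxy
    obtain ⟨w, hxw, hwy⟩ := exists_adj_dist_eq hG hk
    by_contra hne
    have h1 := hG.dist_triangle (u := u) (v := x) (w := w)
    have h2 := hG.dist_triangle (u := u) (v := w) (w := y)
    have h3 := hG.dist_triangle (u := w) (v := y) (w := v)
    have h4 := hG.dist_triangle (u := x) (v := w) (w := v)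
    rcases mem w (by omega) (by omega) with rfl | rfl | rfl | rfl
    · omega
    · simp at hxw
    · simp at hwy; omega
    · omega
  have tri := hG.dist_triangle (u := u) (v := x) (w := v)
  by_contra hne
  obtain ⟨a, ha⟩ := Nat.exists_eq_add_of_le' pux
  have hvy := G.dist_comm (u := v) (v := y)
  have hvx := G.dist_comm (u := v) (v := x)
  obtain ⟨z, hzx, hzy, huz, hvz⟩ := exists_common_neighbor hG hT hC a (G.dist y v) u x y v hadj ha
    (by omega) hvy (by omega) (by omega)
  have hxz := G.dist_comm (u := x) (v := z)
  have hzv := G.dist_comm (u := z) (v := v)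
  rcases mem z (by omega) (by omega) with rfl | rfl | rfl | rfl
  · simp at huz
  · simp at hzx
  · simp at hzy
  · simp at hzv; omega

/-- The walk `u, x, y, v` gives `d(u, v) ≤ 3`. At distance 3, `z` and one of `x`, `y` are neighbours
of the same endpoint and equally far from the other, so the clique condition applies. At distance 2,
`u, x, y, v, z` is a pentagon whose remaining chords reduce to squares. -/
lemma axiomBr_of_conditions (hG : G.Connected) (h4 : NoSquare G) (h5 : NoPentagon G)
    (hC : CliqueCondition G 2) : AxiomBr (interval G) := by
  intro u v x y z hxy hxu hvy hz
  rw [interval_eq_pair_iff hG] at hxy hxu hvy ⊢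
  rw [interval_eq_pair_iff hG]
  simp only [interval, Set.mem_ofPred_eq] at hz
  by_contra! hcon
  have cxu := G.dist_comm (u := x) (v := u)
  have cxy := G.dist_comm (u := x) (v := y)
  have cvy := G.dist_comm (u := v) (v := y)
  have czu := G.dist_comm (u := z) (v := u)
  have czv := G.dist_comm (u := z) (v := v)
  have czx := G.dist_comm (u := z) (v := x)
  have czy := G.dist_comm (u := z) (v := y)
  have cvx := G.dist_comm (u := v) (v := x)
  have cuy := G.dist_comm (u := u) (v := y)
  have cuv := G.dist_comm (u := u) (v := v)
  have t1 := hG.dist_triangle (u := u) (v := x) (w := y)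
  have t2 := hG.dist_triangle (u := u) (v := y) (w := v)
  have t3 := hG.dist_triangle (u := x) (v := y) (w := v)
  have t4 := hG.dist_triangle (u := u) (v := x) (w := v)
  have t5 := hG.dist_triangle (u := x) (v := u) (w := z)
  have t6 := hG.dist_triangle (u := y) (v := v) (w := z)
  have t7 := hG.dist_triangle (u := x) (v := y) (w := z)
  have t8 := hG.dist_triangle (u := y) (v := x) (w := z)
  have puz : G.dist u z ≠ 0 := by omega
  have pvz : G.dist z v ≠ 0 := by omega
  have hle : G.dist u v ≤ 3 := by omega
  rcases Nat.lt_or_ge 2 (G.dist u v) with h3 | h2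
  · rcases Nat.lt_or_ge 1 (G.dist u z) with hlt | hge
    · have := hC u v y z (by omega) (by omega) (by omega) (by omega) (by omega)
      omega
    · have := hC v u x z (by omega) (by omega) (by omega) (by omega) (by omega)
      omega
  · have huz : G.dist u z = 1 := by omega
    have hzv : G.dist z v = 1 := by omega
    have sq : ∀ w, G.dist w u = 1 → G.dist w v = 1 → G.dist w z ≤ 1 := by
      intro w hwu hwv
      have cw := G.dist_comm (u := w) (v := u)
      have := h4 u w v z (by omega) hwv (by omega) (by omega)
      omega
    by_cases hxv : G.dist x v ≤ 1
    · have := sq x (by omega) (by omega); omega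
    by_cases huy : G.dist u y ≤ 1
    · have := sq y (by omega) (by omega); omega
    have := h5 u x y v z (by omega) (by omega) (by omega) (by omega) (by omega)
    omega

/-! ### From the axioms to the conditions -/

lemma noSquare_of_axiomBr (hG : G.Connected) (h : AxiomBr (interval G)) : NoSquare G := by
  intro a b c d hab hbc hcd hda
  by_contra! hcon
  have h1 := hG.dist_triangle (u := a) (v := b) (w := c)
  have cab := G.dist_comm (u := a) (v := b)
  have cbc := G.dist_comm (u := b) (v := c)
  have ccd := G.dist_comm (u := c) (v := d)
  have cda := G.dist_comm (u := d) (v := a)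
  -- Both middle points of (br) are `b`, which turns the axiom into a statement about squares.
  have := h a c b b d ((interval_eq_pair_iff hG).2 (by simp))
    ((interval_eq_pair_iff hG).2 (by omega)) ((interval_eq_pair_iff hG).2 (by omega))
    (by simp only [interval, Set.mem_ofPred_eq]; omega)
  rw [interval_eq_pair_iff hG] at this
  omega

lemma noPentagon_of_axiomBr (hG : G.Connected) (h : AxiomBr (interval G)) : NoPentagon G := by
  intro a b c d e hab hbc hcd hde hea
  by_contra! hcon
  have h1 := hG.dist_triangle (u := d) (v := e) (w := a)
  have cab := G.dist_comm (u := a) (v := b)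
  have ccd := G.dist_comm (u := c) (v := d)
  have cde := G.dist_comm (u := d) (v := e)
  have cea := G.dist_comm (u := e) (v := a)
  have cda := G.dist_comm (u := d) (v := a)
  have ceb := G.dist_comm (u := e) (v := b)
  have := h a d b c e ((interval_eq_pair_iff hG).2 (by omega))
    ((interval_eq_pair_iff hG).2 (by omega)) ((interval_eq_pair_iff hG).2 (by omega))
    (by simp only [interval, Set.mem_ofPred_eq]; omega)
  rw [interval_eq_pair_iff hG, interval_eq_pair_iff hG] at this
  omega

/-- When the conclusion of (J0') fails for a path `u, x, y` with `d(u, y) = 2`, there is a common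
neighbour of `u`, `x` and `y` in `I(x, v)`. -/
lemma exists_mem_interval_of_axiomJ0' (hG : G.Connected) (h4 : NoSquare G)
    (hJ : AxiomJ0' (interval G)) {u x y v : V} (hux : G.dist u x = 1) (hxy : G.dist x y = 1)
    (huy : G.dist u y = 2) (hyv : G.dist y v ≠ 0) (hvx : G.dist x v = G.dist y v + 1)
    (huv : G.dist u v ≠ 0) (huv' : G.dist u v ≤ G.dist x v)
    (hor : G.dist u v ≠ 1 ∨ G.dist y v ≠ 1) :
    ∃ w, G.dist w u = 1 ∧ G.dist w x = 1 ∧ G.dist w y = 1 ∧ G.dist w v = G.dist y v := by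
  have ne : ∀ {p q : V}, G.dist p q ≠ 0 → p ≠ q := fun h e => h (e ▸ dist_self)
  have hnot : ¬ interval G u y ∩ interval G x v ⊂ {u, x, y, v} := by
    intro hsub
    have := hJ u x y v (ne (by omega)) (ne (by omega)) (ne huv) (ne (by omega)) (ne (by omega))
      (ne hyv) (by simp only [interval, Set.mem_ofPred_eq]; omega)
      (by simp only [interval, Set.mem_ofPred_eq]; omega) hsub
    simp only [interval, Set.mem_ofPred_eq] at this
    omega
  -- The inclusion in (J0') is proper, so equality is ruled out separately: `v` in `I(u, y)` would
  -- make `v` adjacent to both `u` and `y`, against `hor`.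
  have cvy := G.dist_comm (u := v) (v := y)
  have hnsub : ¬ interval G u y ∩ interval G x v ⊆ {u, x, y, v} := by
    intro hsub
    refine hnot ⟨hsub, fun hsup => ?_⟩
    have hv := (hsup (by simp : v ∈ ({u, x, y, v} : Set V))).1
    simp only [interval, Set.mem_ofPred_eq] at hv
    omega
  obtain ⟨w, ⟨hw1, hw2⟩, hw⟩ := Set.not_subset.1 hnsub
  simp only [interval, Set.mem_ofPred_eq, Set.mem_insert_iff, Set.mem_singleton_iff,
    not_or] at hw1 hw2 hw
  have pu := hG.pos_dist_of_ne hw.1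
  have px := hG.pos_dist_of_ne hw.2.1
  have py := hG.pos_dist_of_ne hw.2.2.1
  have cwu := G.dist_comm (u := w) (v := u)
  have cwx := G.dist_comm (u := w) (v := x)
  have cwy := G.dist_comm (u := w) (v := y)
  have := h4 u x y w hux hxy (by omega) (by omega)
  exact ⟨w, by omega, by omega, by omega, by omega⟩

lemma triangleCondition_of_axioms (hG : G.Connected) (hJ : AxiomJ0' (interval G))
    (h4 : NoSquare G) (k : ℕ) : TriangleCondition G k := by
  intro v u x hux hu hx
  rcases k with _ | k
  · exact triangleCondition_zero hG v u x hux hu hx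
  rcases Nat.eq_zero_or_pos k with rfl | hk
  · exact ⟨v, by simpa using hu, by simpa using hx, by simp⟩
  have cu := G.dist_comm (u := u) (v := v)
  have cx := G.dist_comm (u := x) (v := v)
  have cux := G.dist_comm (u := u) (v := x)
  -- Either `u'` is already adjacent to `x`, or (J0') along `x, u, u'` provides the required vertex.
  obtain ⟨u', huu', hu'v⟩ := exists_adj_dist_eq hG (by omega : G.dist u v = k + 1)
  have cu' := G.dist_comm (u := u) (v := u')
  have cv' := G.dist_comm (u := v) (v := u')
  have cx' := G.dist_comm (u := x) (v := u')
  have t1 := hG.dist_triangle (u := x) (v := u) (w := u')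
  have t2 := hG.dist_triangle (u := x) (v := u') (w := v)
  rcases Nat.lt_or_ge 1 (G.dist x u') with h | h
  · obtain ⟨w, hwx, hwu, -, hwv⟩ := exists_mem_interval_of_axiomJ0' hG h4 hJ
      (by omega : G.dist x u = 1) huu' (by omega : G.dist x u' = 2) (v := v) (by omega) (by omega)
      (by omega) (by omega) (by omega)
    exact ⟨w, hwu, hwx, by rw [SimpleGraph.dist_comm]; omega⟩
  · exact ⟨u', by omega, by omega, by omega⟩

lemma cliqueCondition_of_axioms (hG : G.Connected) (hJ : AxiomJ0' (interval G))
    (h4 : NoSquare G) (h5 : NoPentagon G) (k : ℕ) : CliqueCondition G k := by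
  induction k with
  | zero => exact cliqueCondition_zero hG
  | succ k ih =>
    intro v x y z hx hy hz hxy hxz
    by_contra! hyz
    have cxy := G.dist_comm (u := x) (v := y)
    have cvx := G.dist_comm (u := v) (v := x)
    have cvy := G.dist_comm (u := v) (v := y)
    have cvz := G.dist_comm (u := v) (v := z)
    have t1 := hG.dist_triangle (u := y) (v := x) (w := z)
    rcases Nat.eq_zero_or_pos k with rfl | hk
    · have := h4 v y x z (by omega) (by omega) hxz (by omega)
      omega
    -- (J0') along `y, x, z` gives a common neighbour at the level of `y` and `z`, which
    -- `dist_le_one_of_common_neighbor` forbids.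
    obtain ⟨t, hty, htx, htz, htv⟩ := exists_mem_interval_of_axiomJ0' hG h4 hJ
      (by omega : G.dist y x = 1) hxz (by omega) (v := v) (by omega) (by omega) (by omega)
      (by omega) (by omega)
    have := dist_le_one_of_common_neighbor hG h4 h5 (triangleCondition_of_axioms hG hJ h4 _) ih
      hx hy hz (by rw [SimpleGraph.dist_comm]; omega) hxy hxz hty htz
    omega

/-! ### Distances in cycles, and from the conditions to bridgedness -/

lemma le_dist_of_adj_le {W : Type*} {K : SimpleGraph W} (hK : K.Connected) (f : W → ℕ)
    (hf : ∀ a b, K.Adj a b → f b ≤ f a + 1) (a b : W) : f b ≤ f a + K.dist a b := by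
  obtain ⟨w, hw⟩ := hK.exists_walk_length_eq_dist a b
  rw [← hw]
  clear hw
  induction w with
  | nil => simp
  | cons h p ih =>
    have := hf _ _ h
    rw [Walk.length_cons]
    omega

lemma cycleGraph_adj_iff_val {n : ℕ} {i j : Fin n} (hn : 2 ≤ n) : (cycleGraph n).Adj i j ↔
    i.val + 1 = j.val ∨ j.val + 1 = i.val ∨ (i.val = 0 ∧ j.val + 1 = n) ∨
      (j.val = 0 ∧ i.val + 1 = n) := by
  rw [cycleGraph_adj']
  have hi := i.2
  have hj := j.2
  rcases lt_trichotomy i j with h | rfl | h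
  · rw [Fin.coe_sub_iff_le.2 h.le, Fin.coe_sub_iff_lt.2 h]; rw [Fin.lt_def] at h; omega
  · rw [Fin.coe_sub_iff_le.2 le_rfl]; omega
  · rw [Fin.coe_sub_iff_le.2 h.le, Fin.coe_sub_iff_lt.2 h]; rw [Fin.lt_def] at h; omega

/-- The distance in a cycle is at least the length of the shorter arc. -/
lemma le_dist_cycleGraph {n : ℕ} (hn : 2 ≤ n) {i j : Fin n} (hij : i ≤ j) :
    min (j.val - i.val) (n - (j.val - i.val)) ≤ (cycleGraph n).dist i j := by
  obtain ⟨m, rfl⟩ := Nat.exists_eq_add_of_le' (show 1 ≤ n by omega)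
  -- The function is arc length from `i`, which changes by at most one along an edge; the sum of the
  -- two truncated differences is `|t - i|`.
  have := le_dist_of_adj_le cycleGraph_connected
    (fun t : Fin (m + 1) => min ((t.val - i.val) + (i.val - t.val))
      (m + 1 - ((t.val - i.val) + (i.val - t.val)))) (fun a b hab => ?_) i j
  · rw [Fin.le_def] at hij
    omega
  · rw [cycleGraph_adj_iff_val hn] at hab
    have ha := a.2
    have hb := b.2
    have hi := i.2
    omega

lemma dist_iso_le {W W' : Type*} {K : SimpleGraph W} {K' : SimpleGraph W'} (e : K ≃g K')
    (hK' : K'.Connected) (a b : W) : K.dist a b ≤ K'.dist (e a) (e b) := by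
  obtain ⟨w, hw⟩ := hK'.exists_walk_length_eq_dist (e a) (e b)
  have := dist_le ((w.map e.symm.toHom).copy (e.symm_apply_apply a) (e.symm_apply_apply b))
  rwa [Walk.length_copy, Walk.length_map, hw] at this

/-- A closed walk running around an isometric cycle. -/
lemma exists_isClosedWalk_of_isIsometric {n : ℕ} (hn : 3 < n) {H : G.Subgraph}
    (e : cycleGraph n ≃g H.coe) (hH : IsIsometric H) :
    ∃ c : ℕ → V, IsClosedWalk G n c ∧ ∀ i j, i ≤ j → j < n →
      min (j - i) (n - (j - i)) ≤ G.dist (c i) (c j) := by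
  have hlt : ∀ i, i % n < n := fun i => Nat.mod_lt _ (by omega)
  refine ⟨fun i => e ⟨i % n, hlt i⟩, ⟨fun i => by simp, fun i => ?_⟩, fun i j hij hj => ?_⟩
  · refine H.coe_adj_sub _ _ (e.map_adj_iff.2 ?_)
    rw [cycleGraph_adj_iff_val (by omega)]
    have h1 := hlt i
    simp only
    rw [Nat.add_mod, Nat.mod_eq_of_lt (show 1 < n by omega)]
    rcases Nat.lt_or_ge (i % n + 1) n with h | h
    · rw [Nat.mod_eq_of_lt h]; omega
    · rw [show i % n + 1 = n by omega, Nat.mod_self]; omega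
  · have hconn : H.coe.Connected := by
      obtain ⟨m, rfl⟩ := Nat.exists_eq_add_of_le' (show 1 ≤ n by omega)
      exact e.connected_iff.1 cycleGraph_connected
    have h1 := le_dist_cycleGraph (by omega) (i := (⟨i % n, hlt i⟩ : Fin n)) (j := ⟨j % n, hlt j⟩)
      (by rw [Fin.le_def]; simp only; rwa [Nat.mod_eq_of_lt hj, Nat.mod_eq_of_lt (by omega)])
    have h2 := dist_iso_le e hconn ⟨i % n, hlt i⟩ ⟨j % n, hlt j⟩
    rw [hH] at h2
    simp only [Nat.mod_eq_of_lt hj, Nat.mod_eq_of_lt (show i < n by omega)] at h1 h2 ⊢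
    omega

lemma isBridged_of_conditions (hG : G.Connected) (h5 : NoPentagon G)
    (hT : ∀ k, TriangleCondition G k) (hC : ∀ k, CliqueCondition G k) : IsBridged G := by
  rintro n hn H ⟨e⟩ hH
  obtain ⟨c, hc, hlow⟩ := exists_isClosedWalk_of_isIsometric hn e hH
  have half : ∀ {i j : ℕ}, i ≤ j → j < n → G.dist (c i) (c j) = min (j - i) (n - (j - i)) := by
    intro i j hij hj
    have h1 := hlow i j hij hj
    obtain ⟨m, rfl⟩ := Nat.exists_eq_add_of_le hij
    have h2 := hc.dist_le i m
    have h3 := hc.dist_le (i + m) (n - m)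
    rw [show i + m + (n - m) = i + n by omega, hc.periodic, SimpleGraph.dist_comm] at h3
    omega
  rcases Nat.even_or_odd' n with ⟨k, rfl | rfl⟩
  -- Even length: the two cycle neighbours of the antipode of `c 0` are at distance 2, against the
  -- clique condition.
  · obtain ⟨k, rfl⟩ := Nat.exists_eq_add_of_le' (show 2 ≤ k by omega)
    have := hC (k + 1) (c 0) (c (k + 2)) (c (k + 1)) (c (k + 3))
      (by rw [half] <;> omega) (by rw [half] <;> omega) (by rw [half] <;> omega)
      (by rw [SimpleGraph.dist_comm, half] <;> omega) (by rw [half] <;> omega)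
    rw [half] at this <;> omega
  · obtain ⟨k, rfl⟩ := Nat.exists_eq_add_of_le' (show 2 ≤ k by omega)
    rcases Nat.eq_zero_or_pos k with rfl | hk
    · have := h5 (c 0) (c 1) (c 2) (c 3) (c 4) (by rw [half] <;> omega) (by rw [half] <;> omega)
        (by rw [half] <;> omega) (by rw [half] <;> omega)
        (by rw [SimpleGraph.dist_comm, half] <;> omega)
      rw [SimpleGraph.dist_comm (u := c 3) (v := c 0), SimpleGraph.dist_comm (u := c 4) (v := c 1)]
        at this
      repeat rw [half] at this
      all_goals omega
    -- Odd length at least 7: `t` completes the edge opposite `c 0` to a triangle. The clique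
    -- condition at both ends of that edge puts `t` within 1 of `c (k + 1)` and `c (k + 4)`, which
    -- are at distance 3.
    · have hu : G.dist (c 0) (c (k + 2)) = k + 2 := by rw [half] <;> omega
      have hx : G.dist (c 0) (c (k + 3)) = k + 2 := by rw [half] <;> omega
      obtain ⟨t, htu, htx, ht⟩ := hT (k + 2) (c 0) (c (k + 2)) (c (k + 3))
        (by rw [half] <;> omega) hu hx
      rw [SimpleGraph.dist_comm] at htu htx
      have h1 := hC (k + 1) (c 0) (c (k + 2)) t (c (k + 1)) hu (by omega)
        (by rw [half] <;> omega) htu (by rw [SimpleGraph.dist_comm, half] <;> omega)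
      have h2 := hC (k + 1) (c 0) (c (k + 3)) t (c (k + 4)) hx (by omega)
        (by rw [half] <;> omega) htx (by rw [half] <;> omega)
      have h3 := hG.dist_triangle (u := c (k + 1)) (v := t) (w := c (k + 4))
      rw [SimpleGraph.dist_comm] at h1
      have h4 : G.dist (c (k + 1)) (c (k + 4)) = 3 := by rw [half] <;> omega
      omega

end MetricGraph

theorem theorem5p1 {V : Type*} [Finite V] (G : SimpleGraph V) (hG : G.Connected) :
    (MetricGraph.AxiomJ0' (MetricGraph.interval G) ∧
        MetricGraph.AxiomBr (MetricGraph.interval G)) ↔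
      MetricGraph.IsBridged G := by
  constructor
  · rintro ⟨hJ, hbr⟩
    have h4 := MetricGraph.noSquare_of_axiomBr hG hbr
    have h5 := MetricGraph.noPentagon_of_axiomBr hG hbr
    exact MetricGraph.isBridged_of_conditions hG h5
      (MetricGraph.triangleCondition_of_axioms hG hJ h4)
      (MetricGraph.cliqueCondition_of_axioms hG hJ h4 h5)
  · intro hB
    have h := MetricGraph.conditions_of_isBridged hG hB
    exact ⟨MetricGraph.axiomJ0'_of_conditions hG (fun k => (h k).1) (fun k => (h k).2),
      MetricGraph.axiomBr_of_conditions hG (MetricGraph.noSquare_of_isBridged hG hB)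
        (MetricGraph.noPentagon_of_isBridged hG hB) (h 2).2⟩
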